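/- Consider a bufferless single server with preemption and push-out, in steady state on the time axis $\mathbb R$. Messages $n\in\mathbb Z$ arrive at times $T_n$, which form a stationary point process with constant interarrival times $T_{n+1}-T_n=1/\beta$, $\beta>0$. Message $n$ needs a service time $S_n$, where the $S_n$ are i.i.d. copies of a random variable $S$ and are independent of the arrival process. The service of a message starts at its arrival and is aborted (the message is pushed out) when the next message arrives; so message $n$ departs successfully, at time $T_n+S_n$, if and only if $S_n<T_{n+1}-T_n$. For $t\in\mathbb R$ let $A(t)$ and $D(t)$ be the largest arrival time and the largest successful departure time that are $\le t$, let $\tilde A(t)$ be the largest arrival time among the messages that have successfully departed by time $t$, and let $\Delta(t)=A(t)-\tilde A(D(t))$ be the relative age of information. Let $\overline\Delta=\mathsf E\,\Delta(t)$ be its stationary mean. (a) (D/GI/1/1-PO.) Suppose that $\mathsf P(S>0)=1$, $\mathsf E S<\infty$, $\mathsf P(S<1/\beta)>0$ and $\mathsf P(S=1/\beta)=0$. Then, for every $t$, $\Delta(t)$ is integrable and $$\overline\Delta=\mathsf E\left(S\,\middle|\,S<\tfrac1\beta\right)+\frac1\beta\cdot\frac{\mathsf P(S>\frac1\beta)}{\mathsf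 P(S<\frac1\beta)}.$$ (b) (D/M/1/1-PO.) In particular, if $S$ is exponentially distributed with rate $\delta>0$, then, for every $t$, $\Delta(t)$ is integrable and $\overline\Delta=1/\delta$. -/

import Mathlib

open MeasureTheory ProbabilityTheory Set

noncomputable section

namespace PushOut

/-! ### The sample paths of the server

A sample path is given by the arrival times `T n` and the service times `S n` of the messages,
indexed by `n : ℤ` (the system runs over the whole time axis). -/

/-- Message `n` is successfully transmitted: its service, which starts when it arrives, is finished
before the next message arrives and pushes it out. -/
def Succeeds (T S : ℤ → ℝ) (n : ℤ) : Prop :=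
  S n < T (n + 1) - T n

/-- `A(t)`: the largest arrival time `≤ t`. -/
def lastArrival (T : ℤ → ℝ) (t : ℝ) : ℝ :=
  sSup {a | ∃ n, a = T n ∧ T n ≤ t}

/-- `D(t)`: the largest (successful) departure time `≤ t`. -/
def lastDeparture (T S : ℤ → ℝ) (t : ℝ) : ℝ :=
  sSup {x | ∃ n, Succeeds T S n ∧ x = T n + S n ∧ T n + S n ≤ t}

/-- `Ã(t)`: the largest arrival time among the messages that have successfully departed by
time `t`. -/
def lastSuccessfulArrival (T S : ℤ → ℝ) (t : ℝ) : ℝ :=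
  sSup {a | ∃ n, Succeeds T S n ∧ a = T n ∧ T n + S n ≤ t}

/-- The relative age of information `Δ(t) = A(t) - Ã(D(t))`. -/
def relativeAge (T S : ℤ → ℝ) (t : ℝ) : ℝ :=
  lastArrival T t - lastSuccessfulArrival T S (lastDeparture T S t)

/-! ### The stationary D/GI/1/1-PO server -/

/-- The counting measure of the arrival times. -/
def arrivalMeasure (T : ℤ → ℝ) : Measure ℝ :=
  Measure.sum fun n => Measure.dirac (T n)

/-- The D/GI/1/1-PO system in steady state, on the whole time axis: the arrival process is a
stationary point process with constant interarrival times `d`, and the service times are i.i.d. with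
law `ν` and independent of the arrival process. -/
structure IsStationaryDGI {Ω : Type*} [MeasurableSpace Ω] (P : Measure Ω) (d : ℝ) (ν : Measure ℝ)
    (T S : ℤ → Ω → ℝ) : Prop where
  measurable_arrival : ∀ n, Measurable (T n)
  measurable_service : ∀ n, Measurable (S n)
  /-- The interarrival times are all equal to `d`. -/
  interarrival : ∀ᵐ ω ∂P, ∀ n, T (n + 1) ω - T n ω = d
  /-- The usual labelling: `T 0` is the last arrival time `≤ 0`. -/
  label : ∀ᵐ ω ∂P, T 0 ω ≤ 0 ∧ 0 < T 1 ω
  /-- The law of the arrival process is invariant under time shifts. -/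
  stationary : ∀ h : ℝ, IdentDistrib
    (fun ω => (arrivalMeasure fun n => T n ω).map (fun x => x + h))
    (fun ω => arrivalMeasure fun n => T n ω) P P
  /-- The service times have law `ν`. -/
  service_law : ∀ n, P.map (S n) = ν
  service_indep : iIndepFun S P
  /-- The service times are independent of the arrival process. -/
  indep : IndepFun (fun ω n => T n ω) (fun ω n => S n ω) P

end PushOut

end

namespace PushOut

open scoped ENNReal

/-! ### Sample paths -/

/-! Write `d = 1 / β`. On a sample path, `Δ(t)` is `d` times the number of messages that arrived
after the last departed one (`relativeAge_eq_mul_lostCount`). That number is a double sum of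
indicators: message `n` is the latest arrival and still undeparted, and the `k` messages before it
all failed. In expectation, independence makes each term an integral against the law of `T n` times
`P(S ≥ d) ^ k`. The sum over `k` is geometric, with value `1 / P(S < d)`; the sum over `n` replaces
the laws by the intensity of the arrivals, which stationarity forces to be Lebesgue measure over
`d`. Hence the mean is `(∫₀ᵈ P(S > x) dx) / P(S < d)`. The numerator is `E min(S, d)`, which splits
at `d` to give (a); in the exponential case it is `(1 - exp(-δd)) / δ`, which gives (b). -/

theorem arrival_add_nsmul {T : ℤ → ℝ} {d : ℝ} (hT : ∀ n, T (n + 1) - T n = d) (n : ℤ) (k : ℕ) :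
    T (n + k) = T n + k * d := by
  induction k with
  | zero => simp
  | succ k ih =>
    have h := hT (n + k)
    have e : n + ((k + 1 : ℕ) : ℤ) = n + k + 1 := by push_cast; ring
    rw [e]
    push_cast
    linarith

theorem arrival_eq {T : ℤ → ℝ} {d : ℝ} (hT : ∀ n, T (n + 1) - T n = d) (n : ℤ) :
    T n = T 0 + n * d := by
  obtain ⟨k, rfl | rfl⟩ := n.eq_nat_or_neg
  · simpa using arrival_add_nsmul hT 0 k
  · have h := arrival_add_nsmul hT (-(k : ℤ)) k
    rw [neg_add_cancel] at h
    push_cast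
    linarith

theorem arrival_strictMono {T : ℤ → ℝ} {d : ℝ} (hd : 0 < d) (hT : ∀ n, T (n + 1) - T n = d) :
    StrictMono T :=
  strictMono_int_of_lt_succ fun n => by linarith [hT n]

theorem existsUnique_arrival_mem_Ioc {T : ℤ → ℝ} {d : ℝ} (hd : 0 < d)
    (hT : ∀ n, T (n + 1) - T n = d) (t : ℝ) : ∃! n, T n ∈ Ioc (t - d) t := by
  obtain ⟨n, hn, huniq⟩ := existsUnique_add_zsmul_mem_Ioc hd (T 0) (t - d)
  have key : ∀ m, T m ∈ Ioc (t - d) t ↔ T 0 + m • d ∈ Ioc (t - d) (t - d + d) := fun m => by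
    rw [arrival_eq hT m, zsmul_eq_mul, sub_add_cancel]
  exact ⟨n, (key n).2 hn, fun m hm => huniq m ((key m).1 hm)⟩

/-- If `n` is the last message arrived and `m` the last message departed by time `t`, the relative
age of information is the time between their arrivals. -/
theorem relativeAge_eq_arrival_sub {T S : ℤ → ℝ} {t : ℝ} {m n : ℤ} (hT : StrictMono T)
    (hS : ∀ n, 0 < S n) (hn : T n ≤ t) (hn' : t < T (n + 1))
    (hm : Succeeds T S m) (hmt : T m + S m ≤ t)
    (hmax : ∀ j, m < j → j ≤ n → Succeeds T S j → t < T j + S j) :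
    relativeAge T S t = T n - T m := by
  have le_n : ∀ j, T j ≤ t → j ≤ n := fun j hj => by
    by_contra! h
    exact absurd (hT.monotone (Int.add_one_le_of_lt h)) (not_le.2 (hj.trans_lt hn'))
  have le_m : ∀ j, Succeeds T S j → T j + S j ≤ t → j ≤ m := fun j hj hjt => by
    by_contra! h
    exact absurd (hmax j h (le_n j (by linarith [hS j])) hj) (not_lt.2 hjt)
  have hA : lastArrival T t = T n :=
    IsGreatest.csSup_eq ⟨⟨n, rfl, hn⟩, by
      rintro _ ⟨j, rfl, hj⟩
      exact hT.monotone (le_n j hj)⟩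
  have hD : lastDeparture T S t = T m + S m :=
    IsGreatest.csSup_eq ⟨⟨m, hm, rfl, hmt⟩, by
      rintro _ ⟨j, hj, rfl, hjt⟩
      rcases (le_m j hj hjt).eq_or_lt with rfl | h
      · exact le_rfl
      -- Departures keep the order of arrivals: a successful `j < m` leaves before `T (j + 1) ≤ T m
      -- < T m + S m`.
      · have h1 : T (j + 1) ≤ T m := hT.monotone (Int.add_one_le_of_lt h)
        have h2 : S j < T (j + 1) - T j := hj
        linarith [hS m]⟩
  have hA' : lastSuccessfulArrival T S (T m + S m) = T m :=
    IsGreatest.csSup_eq ⟨⟨m, hm, rfl, le_rfl⟩, by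
      rintro _ ⟨j, hj, rfl, hjt⟩
      exact hT.monotone (le_m j hj (hjt.trans hmt))⟩
  rw [relativeAge, hA, hD, hA']

/-- Message `n` is the last one to arrive by time `t`, and none of the messages `n - k, …, n` has
departed by then (the interarrival times being `d`). -/
def RecentLost (d t : ℝ) (T S : ℤ → ℝ) (n : ℤ) (k : ℕ) : Prop :=
  T n ∈ Ioc (t - d) t ∧ t - T n < S n ∧ ∀ j < k, d ≤ S (n - 1 - j)

open Classical in
/-- The number of messages that have arrived since the arrival of the last message departed by
time `t`. -/
noncomputable def lostCount (d t : ℝ) (T S : ℤ → ℝ) : ℝ≥0∞ :=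
  ∑' n : ℤ, ∑' k : ℕ, if RecentLost d t T S n k then 1 else 0

theorem tsum_ite_lt (j : ℕ) : (∑' k : ℕ, if k < j then (1 : ℝ≥0∞) else 0) = j := by
  rw [tsum_eq_sum (s := Finset.range j)]
  · rw [Finset.sum_congr rfl (g := fun _ => (1 : ℝ≥0∞))]
    · simp
    · intro k hk
      rw [if_pos (Finset.mem_range.1 hk)]
  · intro k hk
    rw [if_neg (by simpa using hk)]

/-- Only the latest arrival `n` contributes to the count, and the admissible `k` form an initial
segment of `ℕ`, whose length counts the messages since the last departed one. Finiteness guarantees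
a past success, so no supremum takes its default value. -/
theorem relativeAge_eq_mul_lostCount {T S : ℤ → ℝ} {d t : ℝ} (hd : 0 < d)
    (hT : ∀ n, T (n + 1) - T n = d) (hS : ∀ n, 0 < S n) (hfin : lostCount d t T S ≠ ∞) :
    relativeAge T S t = d * (lostCount d t T S).toReal := by
  classical
  obtain ⟨n, hn, huniq⟩ := existsUnique_arrival_mem_Ioc hd hT t
  have hmono := arrival_strictMono hd hT
  have hcount : lostCount d t T S = ∑' k : ℕ, if RecentLost d t T S n k then 1 else 0 := by
    refine tsum_eq_single n fun m hm => ?_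
    simp only [ENNReal.tsum_eq_zero]
    exact fun k => if_neg fun h => hm (huniq m h.1)
  have hnext : t < T (n + 1) := by linarith [hT n, hn.1]
  have hsucc : ∀ j, Succeeds T S j ↔ S j < d := fun j => by rw [Succeeds, hT]
  suffices h : ∃ j : ℕ, lostCount d t T S = j ∧ relativeAge T S t = T n - T (n - j) by
    obtain ⟨j, hj, hr⟩ := h
    have := arrival_add_nsmul hT (n - j) j
    rw [sub_add_cancel] at this
    rw [hr, hj, ENNReal.toReal_natCast]
    linarith
  rcases le_or_gt (S n) (t - T n) with hSn | hSn
  · refine ⟨0, ?_, ?_⟩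
    · rw [hcount]
      simp only [Nat.cast_zero, ENNReal.tsum_eq_zero]
      exact fun k => if_neg fun h => (not_lt.2 hSn) h.2.1
    · rw [Nat.cast_zero, sub_zero]
      exact relativeAge_eq_arrival_sub hmono hS hn.2 hnext ((hsucc n).2 (by linarith [hn.1]))
        (by linarith) fun j h1 h2 => absurd h1 (not_lt.2 h2)
  · have hex : ∃ j : ℕ, S (n - 1 - j) < d := by
      by_contra! h
      refine hfin ?_
      rw [hcount]
      have : ∀ k, RecentLost d t T S n k := fun k => ⟨hn, hSn, fun j _ => h j⟩
      simp [this]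
    have hj := Nat.find_spec hex
    have hmin : ∀ i < Nat.find hex, d ≤ S (n - 1 - i) := fun i hi => not_lt.1 (Nat.find_min hex hi)
    set j := Nat.find hex
    -- The latest success before `n` is `n - 1 - j`, so the admissible `k` are `0, …, j`.
    refine ⟨j + 1, ?_, ?_⟩
    · rw [hcount, ← tsum_ite_lt]
      refine tsum_congr fun k => if_congr ?_ rfl rfl
      rw [Nat.lt_succ_iff]
      refine ⟨fun h => ?_, fun h => ⟨hn, hSn, fun i hi => hmin i (hi.trans_le h)⟩⟩
      by_contra! hlt
      exact absurd (h.2.2 j hlt) (not_le.2 hj)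
    · have e : n - ((j + 1 : ℕ) : ℤ) = n - 1 - j := by push_cast; ring
      rw [e]
      refine relativeAge_eq_arrival_sub hmono hS hn.2 hnext ((hsucc _).2 hj) ?_ ?_
      · have h1 := hT (n - 1 - j)
        have h2 : T (n - 1 - j + 1) ≤ T n := hmono.monotone (by omega)
        linarith [hn.2]
      · intro i hi1 hi2 hi
        rcases hi2.eq_or_lt with rfl | hlt
        · linarith
        · have h := hmin (n - 1 - i).toNat (by omega)
          rw [Int.toNat_of_nonneg (by omega), sub_sub_cancel] at h
          exact absurd ((hsucc i).1 hi) (not_lt.2 h)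

/-! ### The intensity of the arrival process -/

section Intensity

variable {Ω : Type*} [MeasurableSpace Ω] {P : Measure Ω} {d : ℝ} {ν : Measure ℝ} {T S : ℤ → Ω → ℝ}

/-- The intensity measure of the arrival process. -/
noncomputable def intensity (P : Measure Ω) (T : ℤ → Ω → ℝ) : Measure ℝ :=
  Measure.sum fun n => P.map (T n)

theorem intensity_apply (hT : ∀ n, Measurable (T n)) {B : Set ℝ} (hB : MeasurableSet B) :
    intensity P T B = ∫⁻ ω, arrivalMeasure (fun n => T n ω) B ∂P := by
  simp only [intensity, arrivalMeasure, Measure.sum_apply _ hB]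
  rw [lintegral_tsum]
  · refine tsum_congr fun n => ?_
    rw [Measure.map_apply (hT n) hB, ← lintegral_indicator_one (hT n hB)]
    refine lintegral_congr fun ω => ?_
    rw [Measure.dirac_apply' _ hB]
    rfl
  · intro n
    simp only [Measure.dirac_apply' _ hB]
    exact ((measurable_one.indicator hB).comp (hT n)).aemeasurable

/-- The intensity is the mean of the counting measure, so it inherits the shift invariance of its
law. -/
theorem IsStationaryDGI.isAddLeftInvariant_intensity (H : IsStationaryDGI P d ν T S) :
    (intensity P T).IsAddLeftInvariant := by
  refine ⟨fun h => Measure.ext fun B hB => ?_⟩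
  have hmeas : Measurable fun x : ℝ => x + h := measurable_add_const h
  rw [Measure.map_apply (measurable_const_add h) hB,
    intensity_apply H.measurable_arrival (measurable_const_add h hB),
    intensity_apply H.measurable_arrival hB,
    show ∫⁻ ω, arrivalMeasure (fun n => T n ω) B ∂P =
        ∫⁻ ω, ((arrivalMeasure fun n => T n ω).map fun x => x + h) B ∂P from
      ((H.stationary h).comp (Measure.measurable_coe hB)).lintegral_eq.symm]
  refine lintegral_congr fun ω => ?_
  rw [Measure.map_apply hmeas hB]
  simp only [add_comm]

/-- Almost every path has exactly one arrival in a half-open window of length `d`; this fixes the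
Haar constant. -/
theorem IsStationaryDGI.intensity_Ioc [IsProbabilityMeasure P] (hd : 0 < d)
    (H : IsStationaryDGI P d ν T S) (t : ℝ) : intensity P T (Ioc (t - d) t) = 1 := by
  rw [intensity_apply H.measurable_arrival measurableSet_Ioc,
    lintegral_congr_ae (g := fun _ => 1)]
  · simp
  · filter_upwards [H.interarrival] with ω hω
    obtain ⟨n, hn, huniq⟩ := existsUnique_arrival_mem_Ioc (T := fun n => T n ω) hd hω t
    rw [arrivalMeasure, Measure.sum_apply _ measurableSet_Ioc, tsum_eq_single n]
    · simp [Measure.dirac_apply' _ measurableSet_Ioc, hn.1, hn.2]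
    · intro m hm
      rw [Measure.dirac_apply' _ measurableSet_Ioc]
      exact indicator_of_notMem (fun h => hm (huniq m h)) _

/-- The intensity of the arrivals is `1 / d` times Lebesgue measure. -/
theorem IsStationaryDGI.intensity_eq [IsProbabilityMeasure P] (hd : 0 < d)
    (H : IsStationaryDGI P d ν T S) : intensity P T = (ENNReal.ofReal d)⁻¹ • volume := by
  have := H.isAddLeftInvariant_intensity
  -- Shifting the window by `d / 2` puts `x` in its interior.
  have : IsLocallyFiniteMeasure (intensity P T) := ⟨fun x =>
    ⟨Ioc (x + d / 2 - d) (x + d / 2), Ioc_mem_nhds (by linarith) (by linarith), by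
      rw [H.intensity_Ioc hd]; exact ENNReal.one_lt_top⟩⟩
  have h := Measure.isAddLeftInvariant_eq_smul (intensity P T) volume
  have h1 := H.intensity_Ioc hd 0
  rw [h] at h1 ⊢
  rw [Measure.smul_apply, Real.volume_Ioc, sub_sub_cancel, ENNReal.smul_def, smul_eq_mul] at h1
  rw [← ENNReal.eq_inv_of_mul_eq_one_left h1]
  rfl

end Intensity

/-! ### The stationary mean -/

section Mean

variable {Ω : Type*} [MeasurableSpace Ω] {P : Measure Ω} {d : ℝ}
  {ν : Measure ℝ} {T S : ℤ → Ω → ℝ}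

/-- The messages `n, n - 1, …, n - k` are distinct, so their service times are independent; index
`0` carries `Ioi x` and the others `Ici d`. -/
theorem IsStationaryDGI.measure_service [IsProbabilityMeasure P]
    (H : IsStationaryDGI P d ν T S) (n : ℤ) (k : ℕ) (x : ℝ) :
    P {ω | x < S n ω ∧ ∀ j < k, d ≤ S (n - 1 - j) ω} = ν (Ioi x) * ν (Ici d) ^ k := by
  have hinj : Function.Injective fun i : ℕ => n - (i : ℤ) := fun i j h => by
    simp only at h; omega
  have hmeas : ∀ i ∈ Finset.range (k + 1),
      MeasurableSet (if i = 0 then Ioi x else Ici d) := fun i _ => by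
    split_ifs
    exacts [measurableSet_Ioi, measurableSet_Ici]
  have key := (H.service_indep.precomp hinj).measure_inter_preimage_eq_mul
    (Finset.range (k + 1)) (sets := fun i => if i = 0 then Ioi x else Ici d) hmeas
  have hlaw : ∀ i (B : Set ℝ), MeasurableSet B → P (S i ⁻¹' B) = ν B := fun i B hB => by
    rw [← Measure.map_apply (H.measurable_service i) hB, H.service_law]
  rw [Finset.prod_range_succ'] at key
  simp only [Nat.add_eq_zero_iff, one_ne_zero, and_false, if_false, if_true,
    hlaw _ _ measurableSet_Ici, hlaw _ _ measurableSet_Ioi, Finset.prod_const,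
    Finset.card_range] at key
  rw [mul_comm, ← key]
  congr 1
  ext ω
  simp only [mem_ofPred_eq, mem_iInter, Finset.mem_range, mem_preimage]
  constructor
  · rintro ⟨h0, h⟩ i hi
    rcases i with _ | i
    · simpa using h0
    · have := h i (by omega)
      simp only [Nat.add_eq_zero_iff, one_ne_zero, and_false, if_false, mem_Ici]
      rwa [show n - ((i + 1 : ℕ) : ℤ) = n - 1 - i by push_cast; ring]
  · intro h
    refine ⟨by simpa using h 0 (by omega), fun j hj => ?_⟩
    have := h (j + 1) (by omega)
    simp only [Nat.add_eq_zero_iff, one_ne_zero, and_false, if_false, mem_Ici] at this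
    rwa [show n - ((j + 1 : ℕ) : ℤ) = n - 1 - j by push_cast; ring] at this

theorem measurableSet_recentLost_section (d t : ℝ) (n : ℤ) (k : ℕ) :
    MeasurableSet {p : ℝ × (ℤ → ℝ) |
      p.1 ∈ Ioc (t - d) t ∧ t - p.1 < p.2 n ∧ ∀ j < k, d ≤ p.2 (n - 1 - j)} := by
  have h1 : MeasurableSet {p : ℝ × (ℤ → ℝ) | p.1 ∈ Ioc (t - d) t} :=
    measurable_fst measurableSet_Ioc
  have h2 : MeasurableSet {p : ℝ × (ℤ → ℝ) | t - p.1 < p.2 n} :=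
    measurableSet_lt (by fun_prop) (by fun_prop)
  have h3 : MeasurableSet {p : ℝ × (ℤ → ℝ) | ∀ j < k, d ≤ p.2 (n - 1 - j)} := by
    have : {p : ℝ × (ℤ → ℝ) | ∀ j < k, d ≤ p.2 (n - 1 - j)} =
        ⋂ j ∈ Finset.range k, {p : ℝ × (ℤ → ℝ) | d ≤ p.2 (n - 1 - (j : ℤ))} := by
      ext p; simp
    rw [this]
    exact Finset.measurableSet_biInter _ fun j _ =>
      measurableSet_le (by fun_prop) (by fun_prop)
  exact h1.inter (h2.inter h3)

theorem IsStationaryDGI.measurableSet_recentLost (H : IsStationaryDGI P d ν T S) (t : ℝ) (n : ℤ)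
    (k : ℕ) : MeasurableSet {ω | RecentLost d t (fun n => T n ω) (fun n => S n ω) n k} :=
  ((H.measurable_arrival n).prodMk (measurable_pi_lambda _ H.measurable_service))
    (measurableSet_recentLost_section d t n k)

/-- Fubini: freeze `T n = x`, which is independent of all service times. -/
theorem IsStationaryDGI.measure_recentLost [IsProbabilityMeasure P]
    (H : IsStationaryDGI P d ν T S) (t : ℝ) (n : ℤ)
    (k : ℕ) : P {ω | RecentLost d t (fun n => T n ω) (fun n => S n ω) n k} =
      (∫⁻ x in Ioc (t - d) t, ν (Ioi (t - x)) ∂(P.map (T n))) * ν (Ici d) ^ k := by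
  have hT := H.measurable_arrival n
  have hS : Measurable fun ω n => S n ω := measurable_pi_lambda _ H.measurable_service
  have hA := measurableSet_recentLost_section d t n k
  have hind : IndepFun (T n) (fun ω n => S n ω) P :=
    H.indep.comp (measurable_pi_apply n) measurable_id
  have := Measure.isProbabilityMeasure_map hS.aemeasurable (μ := P)
  have hν : Antitone fun x => ν (Ioi x) := fun x y h => measure_mono (Ioi_subset_Ioi h)
  have hνm : Measurable fun x => ν (Ioi (t - x)) :=
    hν.measurable.comp (measurable_const.sub measurable_id)
  rw [← lintegral_mul_const _ hνm,
    ← lintegral_indicator measurableSet_Ioc]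
  have hset : {ω | RecentLost d t (fun n => T n ω) (fun n => S n ω) n k} =
      (fun ω => (T n ω, fun n => S n ω)) ⁻¹' {p : ℝ × (ℤ → ℝ) |
        p.1 ∈ Ioc (t - d) t ∧ t - p.1 < p.2 n ∧ ∀ j < k, d ≤ p.2 (n - 1 - j)} := rfl
  rw [hset, ← Measure.map_apply (hT.prodMk hS) hA, hind.map_prod_eq_prod_map_map hT.aemeasurable
    hS.aemeasurable, Measure.prod_apply hA]
  refine lintegral_congr fun x => ?_
  rw [Measure.map_apply hS (measurable_prodMk_left hA)]
  by_cases hx : x ∈ Ioc (t - d) t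
  · rw [indicator_of_mem hx, ← H.measure_service n]
    congr 1
    ext ω
    simp [hx.1, hx.2]
  · rw [indicator_of_notMem hx]
    convert measure_empty (μ := P)
    ext ω
    simp only [mem_preimage, mem_ofPred_eq, mem_empty_iff_false, iff_false]
    exact fun h => hx h.1

theorem IsStationaryDGI.measurable_lostCount (H : IsStationaryDGI P d ν T S) (t : ℝ) :
    Measurable fun ω => lostCount d t (fun n => T n ω) (fun n => S n ω) :=
  Measurable.tsum fun n => Measurable.tsum fun k =>
    Measurable.ite (H.measurableSet_recentLost t n k) measurable_const measurable_const

theorem lintegral_Ioc_reflect (f : ℝ → ℝ≥0∞) (d t : ℝ) :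
    ∫⁻ x in Ioc (t - d) t, f (t - x) = ∫⁻ x in Ico 0 d, f x := by
  rw [← lintegral_indicator measurableSet_Ioc, ← lintegral_indicator measurableSet_Ico,
    ← lintegral_sub_left_eq_self ((Ico 0 d).indicator f) t]
  refine lintegral_congr fun x => ?_
  have : x ∈ Ioc (t - d) t ↔ t - x ∈ Ico 0 d := by
    simp only [mem_Ioc, mem_Ico]
    constructor <;> rintro ⟨h1, h2⟩ <;> constructor <;> linarith
  by_cases hx : x ∈ Ioc (t - d) t
  · rw [indicator_of_mem hx, indicator_of_mem (this.1 hx)]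
  · rw [indicator_of_notMem hx, indicator_of_notMem (mt this.2 hx)]

theorem IsStationaryDGI.lintegral_lostCount [IsProbabilityMeasure P] [IsProbabilityMeasure ν] (hd : 0 < d)
    (H : IsStationaryDGI P d ν T S) (t : ℝ) :
    ∫⁻ ω, lostCount d t (fun n => T n ω) (fun n => S n ω) ∂P =
      (ENNReal.ofReal d)⁻¹ * (∫⁻ x in Ico 0 d, ν (Ioi x)) * (ν (Iio d))⁻¹ := by
  classical
  have hmeas := H.measurableSet_recentLost t
  have hp : ν (Iio d) = 1 - ν (Ici d) := by
    rw [← compl_Ici, prob_compl_eq_one_sub measurableSet_Ici]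
  simp only [lostCount]
  rw [lintegral_tsum fun n => (Measurable.tsum fun k =>
    Measurable.ite (hmeas n k) measurable_const measurable_const).aemeasurable]
  have hterm : ∀ n, ∫⁻ ω, ∑' k : ℕ, (if RecentLost d t (fun n => T n ω) (fun n => S n ω) n k
      then (1 : ℝ≥0∞) else 0) ∂P =
      (∫⁻ x in Ioc (t - d) t, ν (Ioi (t - x)) ∂(P.map (T n))) * (ν (Iio d))⁻¹ := fun n => by
    rw [lintegral_tsum fun k =>
      (Measurable.ite (hmeas n k) measurable_const measurable_const).aemeasurable,
      hp, ← ENNReal.tsum_geometric, ← ENNReal.tsum_mul_left]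
    refine tsum_congr fun k => ?_
    rw [← H.measure_recentLost, ← lintegral_indicator_one (hmeas n k)]
    exact lintegral_congr fun ω => by simp [indicator_apply]
  rw [tsum_congr hterm, ENNReal.tsum_mul_right, ← lintegral_sum_measure,
    ← Measure.restrict_sum _ measurableSet_Ioc]
  change (∫⁻ x in _, _ ∂(intensity P T)) * _ = _
  rw [H.intensity_eq hd, Measure.restrict_smul, lintegral_smul_measure, smul_eq_mul,
    lintegral_Ioc_reflect fun x => ν (Ioi x)]

/-- The stationary mean of the relative age of information, in terms of the tail of the service
law. -/
theorem IsStationaryDGI.integral_relativeAge [IsProbabilityMeasure P] [IsProbabilityMeasure ν]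
    (hd : 0 < d)   (hpos : ν (Iic 0) = 0) (hp : 0 < ν (Iio d)) (H : IsStationaryDGI P d ν T S) (t : ℝ) :
    Integrable (fun ω => relativeAge (fun n => T n ω) (fun n => S n ω) t) P ∧
      ∫ ω, relativeAge (fun n => T n ω) (fun n => S n ω) t ∂P =
        (∫⁻ x in Ico 0 d, ν (Ioi x)).toReal / ν.real (Iio d) := by
  have hI : ∫⁻ x in Ico 0 d, ν (Ioi x) ≠ ∞ := by
    refine ((setLIntegral_mono measurable_const fun x _ => prob_le_one).trans_lt ?_).ne
    simp
  have hlint := H.lintegral_lostCount hd t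
  have hd' : ENNReal.ofReal d ≠ 0 := by simpa using hd
  have hfin : ∫⁻ ω, lostCount d t (fun n => T n ω) (fun n => S n ω) ∂P ≠ ∞ := by
    rw [hlint]
    exact ENNReal.mul_ne_top (ENNReal.mul_ne_top (ENNReal.inv_ne_top.2 hd') hI)
      (ENNReal.inv_ne_top.2 hp.ne')
  have hmeas := H.measurable_lostCount t
  have hae : (fun ω => relativeAge (fun n => T n ω) (fun n => S n ω) t) =ᵐ[P]
      fun ω => d * (lostCount d t (fun n => T n ω) (fun n => S n ω)).toReal := by
    have hS : ∀ᵐ ω ∂P, ∀ n, 0 < S n ω := ae_all_iff.2 fun n => by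
      rw [ae_iff]
      simp only [not_lt]
      change P (S n ⁻¹' Iic 0) = 0
      rw [← Measure.map_apply (H.measurable_service n) measurableSet_Iic, H.service_law, hpos]
    -- A finite mean makes the count almost surely finite, which discards the paths with no past
    -- success.
    filter_upwards [hS, H.interarrival, ae_lt_top hmeas hfin] with ω h1 h2 h3
    exact relativeAge_eq_mul_lostCount hd h2 h1 h3.ne
  refine ⟨((integrable_toReal_of_lintegral_ne_top hmeas.aemeasurable hfin).const_mul d).congr
    hae.symm, ?_⟩
  rw [integral_congr_ae hae, integral_const_mul,
    integral_toReal hmeas.aemeasurable (ae_lt_top hmeas hfin), hlint, ENNReal.toReal_mul,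
    ENNReal.toReal_mul, ENNReal.toReal_inv, ENNReal.toReal_inv, ENNReal.toReal_ofReal hd.le]
  rw [Measure.real]
  field_simp

end Mean

/-! ### Evaluation of the mean -/

/-- Layer-cake formula for `min s d`: its tail agrees with that of `s` below `d` and vanishes from
`d` on. -/
theorem toReal_lintegral_tail {ν : Measure ℝ} [IsProbabilityMeasure ν] {d : ℝ} (hd : 0 < d)
    (hpos : ν (Iic 0) = 0) (hint : Integrable (fun s => s) ν) :
    (∫⁻ x in Ico 0 d, ν (Ioi x)).toReal = ∫ s in Iio d, s ∂ν + d * ν.real (Ici d) := by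
  have hnn : ∀ᵐ s ∂ν, 0 < s := by
    rw [ae_iff]
    simp only [not_lt]
    exact hpos
  have hmin : ∀ᵐ s ∂ν, 0 ≤ min s d := hnn.mono fun s hs => le_min hs.le hd.le
  have hmeas : AEMeasurable (fun s : ℝ => min s d) ν := by fun_prop
  have hlayer : ∫⁻ x in Ico 0 d, ν (Ioi x) = ∫⁻ s, ENNReal.ofReal (min s d) ∂ν := by
    rw [lintegral_eq_lintegral_meas_lt ν hmin hmeas, setLIntegral_congr Ioo_ae_eq_Ico.symm,
      ← lintegral_indicator measurableSet_Ioo, ← lintegral_indicator measurableSet_Ioi]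
    refine lintegral_congr fun x => ?_
    by_cases h0 : 0 < x
    · rw [indicator_of_mem (mem_Ioi.2 h0)]
      by_cases hx : x < d
      · rw [indicator_of_mem (mem_Ioo.2 ⟨h0, hx⟩)]
        congr 1
        ext s
        simp [hx]
      · rw [indicator_of_notMem fun h => hx (mem_Ioo.1 h).2]
        simp [hx]
    · rw [indicator_of_notMem (fun h => h0 (mem_Ioo.1 h).1), indicator_of_notMem (s := Ioi 0) h0]
  rw [hlayer, ← integral_eq_lintegral_of_nonneg_ae hmin hmeas.aestronglyMeasurable]
  have hmi : Integrable (fun s : ℝ => min s d) ν := hint.inf (integrable_const d)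
  rw [← integral_add_compl (measurableSet_Iio (a := d)) hmi, compl_Iio,
    setIntegral_congr_fun measurableSet_Iio (g := fun s => s) fun s hs => min_eq_left (le_of_lt hs),
    setIntegral_congr_fun measurableSet_Ici (g := fun _ => d) fun s hs => min_eq_right hs]
  simp [mul_comm]

theorem expMeasure_real_Iic {δ : ℝ} (hδ : 0 < δ) {x : ℝ} (hx : 0 ≤ x) :
    (expMeasure δ).real (Iic x) = 1 - Real.exp (-(δ * x)) := by
  have := isProbabilityMeasure_expMeasure hδ
  rw [← cdf_eq_real, cdf_expMeasure_eq hδ, if_pos hx]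

theorem expMeasure_singleton (δ x : ℝ) : expMeasure δ {x} = 0 := by
  have h : expMeasure δ ≪ volume := withDensity_absolutelyContinuous _ _
  exact h Real.volume_singleton

theorem expMeasure_Ioi {δ : ℝ} (hδ : 0 < δ) {x : ℝ} (hx : 0 ≤ x) :
    expMeasure δ (Ioi x) = ENNReal.ofReal (Real.exp (-(δ * x))) := by
  have := isProbabilityMeasure_expMeasure hδ
  rw [← ofReal_measureReal, ← compl_Iic, probReal_compl_eq_one_sub measurableSet_Iic,
    expMeasure_real_Iic hδ hx, sub_sub_cancel]

theorem toReal_lintegral_tail_expMeasure {δ d : ℝ} (hδ : 0 < δ) (hd : 0 ≤ d) :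
    (∫⁻ x in Ico 0 d, expMeasure δ (Ioi x)).toReal = (1 - Real.exp (-(δ * d))) / δ := by
  rw [setLIntegral_congr_fun measurableSet_Ico fun x hx => expMeasure_Ioi hδ hx.1,
    setLIntegral_congr Ico_ae_eq_Ioc, ← integral_eq_lintegral_of_nonneg_ae
      (ae_of_all _ fun x => (Real.exp_pos _).le) (by fun_prop),
    ← intervalIntegral.integral_of_le hd]
  have hderiv : ∀ x ∈ uIcc 0 d, HasDerivAt (fun x => -Real.exp (-(δ * x)) / δ)
      (Real.exp (-(δ * x))) x := fun x _ => by
    have h : HasDerivAt (fun x => -Real.exp (-(δ * x)) / δ)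
        (-(Real.exp (-(δ * x)) * -(δ * 1)) / δ) x :=
      (((hasDerivAt_id x).const_mul δ).neg.exp.neg).div_const δ
    rwa [mul_one, mul_neg, neg_neg, mul_div_cancel_right₀ _ hδ.ne'] at h
  rw [intervalIntegral.integral_eq_sub_of_hasDerivAt hderiv
    (Continuous.intervalIntegrable (by fun_prop) _ _)]
  simp
  ring

end PushOut

/-- The stationary mean of the relative age of information of the D/GI/1/1-PO server with
interarrival time `1 / β` and service law `ν`, and of the D/M/1/1-PO server with rate `δ`. -/
theorem corollary2 {Ω : Type*} [MeasurableSpace Ω] (P : Measure Ω) [IsProbabilityMeasure P]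
    (β : ℝ) (hβ : 0 < β) (T S : ℤ → Ω → ℝ) :
    (∀ ν : Measure ℝ, IsProbabilityMeasure ν →
      ν (Iic 0) = 0 → Integrable (fun s => s) ν →
      0 < ν (Iio (1 / β)) → ν {1 / β} = 0 →
      PushOut.IsStationaryDGI P (1 / β) ν T S →
      ∀ t : ℝ,
        Integrable (fun ω => PushOut.relativeAge (fun n => T n ω) (fun n => S n ω) t) P ∧
        ∫ ω, PushOut.relativeAge (fun n => T n ω) (fun n => S n ω) t ∂P =
          (∫ s, s ∂(ProbabilityTheory.cond ν (Iio (1 / β)))) +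
            (1 / β) * (ν.real (Ioi (1 / β)) / ν.real (Iio (1 / β)))) ∧
    (∀ δ : ℝ, 0 < δ →
      PushOut.IsStationaryDGI P (1 / β) (expMeasure δ) T S →
      ∀ t : ℝ,
        Integrable (fun ω => PushOut.relativeAge (fun n => T n ω) (fun n => S n ω) t) P ∧
        ∫ ω, PushOut.relativeAge (fun n => T n ω) (fun n => S n ω) t ∂P = 1 / δ) := by
  have hd : 0 < 1 / β := one_div_pos.2 hβ
  refine ⟨fun ν _ hpos hint hp hatom H t => ?_, fun δ hδ H t => ?_⟩
  · obtain ⟨hi, he⟩ := H.integral_relativeAge hd hpos hp t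
    refine ⟨hi, ?_⟩
    have hp' : ν.real (Iio (1 / β)) ≠ 0 := (ENNReal.toReal_pos hp.ne' (measure_ne_top _ _)).ne'
    -- The absence of an atom at `1 / β` is used here.
    have htail : ν.real (Ici (1 / β)) = ν.real (Ioi (1 / β)) :=
      measureReal_congr (Ioi_ae_eq_Ici' hatom).symm
    rw [he, PushOut.toReal_lintegral_tail hd hpos hint, htail, ProbabilityTheory.cond,
      integral_smul_measure, ENNReal.toReal_inv, ← Measure.real, smul_eq_mul]
    field_simp
  · have := isProbabilityMeasure_expMeasure hδ
    have hexp : Real.exp (-(δ * (1 / β))) < 1 :=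
      Real.exp_lt_one_iff.2 (neg_neg_of_pos (mul_pos hδ hd))
    have hIio : (expMeasure δ).real (Iio (1 / β)) = 1 - Real.exp (-(δ * (1 / β))) := by
      rw [← PushOut.expMeasure_real_Iic hδ hd.le]
      exact measureReal_congr (Iio_ae_eq_Iic' (PushOut.expMeasure_singleton δ _))
    have hpos : expMeasure δ (Iic 0) = 0 := by
      rw [← measureReal_eq_zero_iff, PushOut.expMeasure_real_Iic hδ le_rfl]
      simp
    have hp : 0 < expMeasure δ (Iio (1 / β)) := by
      rw [pos_iff_ne_zero, ← measureReal_ne_zero_iff, hIio]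
      linarith
    obtain ⟨hi, he⟩ := H.integral_relativeAge hd hpos hp t
    refine ⟨hi, ?_⟩
    rw [he, PushOut.toReal_lintegral_tail_expMeasure hδ hd.le, hIio]
    have : 1 - Real.exp (-(δ * (1 / β))) ≠ 0 := by linarith
    rw [div_right_comm, div_self this]
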